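/- Let $X_1,X_2,\dots$ be i.i.d. real random variables with distribution function $F$, let $\gamma>0$, and put $V(t):=F^{\leftarrow}(e^{-1/t})=\inf\{x\in\mathbb R: F(x)\ge e^{-1/t}\}$ for $t>0$. For an integer $m\ge 1$, Condition B for $F^m$ (with index $\gamma$) is the following: (A1) $V$ is positive for large arguments; $\lim_{t\to\infty}\bigl(\log V(tx)-\log V(t)\bigr)=\gamma\log x$ for all $x>0$; and for all $\varepsilon,\delta>0$ there is $t_0=t_0(\varepsilon,\delta)$ such that $\bigl|V(tx)/V(t)-x^{\gamma}\bigr|\le\varepsilon x^{\gamma+\delta}$ for all $t\ge t_0$ and $x\ge 1$; (B) for all $x>0$, $$\lim_{t\to\infty}\frac{1-F^m\bigl(x\,V(m(t-\tfrac12))\bigr)}{1-F^m\bigl(V(m(t-\tfrac12))\bigr)}=x^{-1/\gamma}.$$ Let $M^{(m)}_i:=\max_{(i-1)m<j\le im}X_j$, $i=1,2,\dots$, be the block maxima of block length $m$, let $M^{(m)}_{1:k}\le\dots\le M^{(m)}_{k:k}$ be the order statistics of $M^{(m)}_1,\dots,M^{(m)}_k$, and define the hybrid-Hill (H2) estimator,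 for $1\le k_0<k$, by $$\hat\gamma^{\mathrm{H2}}(k_0,k):=\frac1{k_0}\sum_{i=0}^{k_0-1}\bigl(\log M^{(m)}_{k-i:k}-\log M^{(m)}_{k-k_0:k}\bigr).$$ **Theorem (consistency of the hybrid-Hill estimator).** Let $m\ge 1$ and assume that $F^m$ satisfies Condition B with index $\gamma>0$. Let $(\vartheta_k)_{k\ge1}$ be positive constants with $\sqrt{k}\,\vartheta_k^{-3}\to0$ as $k\to\infty$. If the integers $k_0=k_0(k)$ satisfy $k_0\to\infty$ and $\vartheta_k k_0=o(\sqrt k)$ as $k\to\infty$, then $$\hat\gamma^{\mathrm{H2}}(k_0,k)\xrightarrow{\;P\;}\gamma\qquad(k\to\infty).$$ (The hypotheses force $k_0<k$ for large $k$, and with probability tending to one the order statistics that occur are positive, so that the estimator is well defined.) -/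

import Mathlib

open Filter Topology Asymptotics MeasureTheory ProbabilityTheory

namespace HybridHill

noncomputable section

/-- The quantile-type function `V(t) = F^←(e^{-1/t})`, `t > 0`, of a distribution function `F`,
with the left-continuous generalised inverse `F^←(p) = inf {x : F x ≥ p}`. For `t > 0` the set is
non-empty and bounded below, since `0 < e^{-1/t} < 1`. -/
def tailQuantile (F : ℝ → ℝ) (t : ℝ) : ℝ :=
  sInf {x : ℝ | Real.exp (-1 / t) ≤ F x}

/-- Condition A1 with index `γ`, for a function `V` (positive for large arguments, so that the
logarithms and quotients are meaningful). -/
structure ConditionA1 (V : ℝ → ℝ) (γ : ℝ) : Prop where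
  eventually_pos : ∀ᶠ t in atTop, 0 < V t
  tendsto_log : ∀ x : ℝ, 0 < x →
    Tendsto (fun t : ℝ => Real.log (V (t * x)) - Real.log (V t)) atTop (𝓝 (γ * Real.log x))
  uniform_bound : ∀ ε δ : ℝ, 0 < ε → 0 < δ → ∃ t₀ : ℝ, ∀ t x : ℝ, t₀ ≤ t → 1 ≤ x →
    |V (t * x) / V t - x ^ γ| ≤ ε * x ^ (γ + δ)

/-- Condition B with index `γ`, for the distribution function `F ^ m` of a maximum over a block of
length `m`: the function `V` of `F` satisfies Condition A1, and the tail `1 - F ^ m`, normalised by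
`V (m (t - 1/2))`, is asymptotically Pareto. -/
structure ConditionB (F : ℝ → ℝ) (m : ℕ) (γ : ℝ) : Prop where
  conditionA1 : ConditionA1 (tailQuantile F) γ
  tendsto_tail : ∀ x : ℝ, 0 < x →
    Tendsto (fun t : ℝ =>
        (1 - F (x * tailQuantile F (m * (t - 1 / 2))) ^ m) /
          (1 - F (tailQuantile F (m * (t - 1 / 2))) ^ m))
      atTop (𝓝 (x ^ (-1 / γ)))

/-- The maximum of `X` over the block number `i` of length `m` (blocks and variables are numbered
from `0`): the largest of `X (i m), …, X (i m + m - 1)`. It is used for `m ≥ 1` only, when the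
supremum over `Fin m` is a maximum over a non-empty finite set. -/
def blockMax {Ω : Type*} (X : ℕ → Ω → ℝ) (m i : ℕ) (w : Ω) : ℝ :=
  ⨆ j : Fin m, X (i * m + j) w

/-- The `j`-th smallest value `v_{j:k}` of a sample `v` of size `k`, for `1 ≤ j ≤ k`
(and `0` for other `j`). -/
def orderStat {k : ℕ} (v : Fin k → ℝ) (j : ℕ) : ℝ :=
  if h : 1 ≤ j ∧ j ≤ k then v (Tuple.sort v ⟨j - 1, by omega⟩) else 0

/-- The Hill estimator on the `k₀` upper order statistics of a sample of size `k` (`k₀ < k`):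
`(1 / k₀) ∑_{i < k₀} (log v_{k-i:k} - log v_{k-k₀:k})`. -/
def hill {k : ℕ} (v : Fin k → ℝ) (k₀ : ℕ) : ℝ :=
  (1 / (k₀ : ℝ)) * ∑ i ∈ Finset.range k₀,
    (Real.log (orderStat v (k - i)) - Real.log (orderStat v (k - k₀)))

/-- The hybrid-Hill (H2) estimator: the Hill estimator on the `k₀` largest of the first `k` block
maxima of block length `m`. -/
def hybridHill {Ω : Type*} (X : ℕ → Ω → ℝ) (m k₀ k : ℕ) (w : Ω) : ℝ :=
  hill (fun i : Fin k => blockMax X m i w) k₀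

end

end HybridHill

/-! ### Quantile transform by an exponential variable. -/

namespace HybridHill

open Set

/-! The random threshold of the Hill estimator is trapped between two deterministic ones, `V (c m k
/ k₀)` and `V (c' m k / k₀)` with `c < 1 < c'`. Lowering the threshold raises the sum of
log-excesses and raising it lowers the sum, so on the event that the thresholds trap it, the
estimator lies between the two deterministic-threshold sums divided by `k₀` (`hill_mem_Icc`).
Trapping is a statement about exceedance counts, so both counts and log-excess sums are handled by
one law of large numbers for `logExcess`, with exponent 0 or 1.

The means come from writing a block maximum in law as `V (t / E)` with `E` exponential of rate `m /
t` (`map_expLaw_tailQuantile`). After scaling by `t / m`, the density of `E` tends to 1 pointwise,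
and by Condition A1 and dominated convergence the `n`-th moment tends to the integral of `(-γ log s)
^ n` over `(0, 1)` (`logExcess_moments`): 1 for `n = 0`, `γ` for `n = 1`. At `t = c m k / k₀` the
normalised count and sum thus tend to `1 / c` and `γ / c`; Chebyshev controls the fluctuations.
Finally `c` and `c'` are taken close to 1. -/

/-- The quantile function is the lower adjoint of the distribution function. -/
theorem tailQuantile_le_iff (ρ : Measure ℝ) {t : ℝ} (ht : 0 < t) (y : ℝ) :
    tailQuantile (cdf ρ) t ≤ y ↔ Real.exp (-1 / t) ≤ cdf ρ y := by
  have h1 : Real.exp (-1 / t) < 1 :=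
    Real.exp_lt_one_iff.2 (div_neg_of_neg_of_pos (by norm_num) ht)
  have hne : {x : ℝ | Real.exp (-1 / t) ≤ cdf ρ x}.Nonempty :=
    (((tendsto_cdf_atTop ρ).eventually (lt_mem_nhds h1)).exists).imp fun _ h => h.le
  have hbdd : BddBelow {x : ℝ | Real.exp (-1 / t) ≤ cdf ρ x} := by
    obtain ⟨b, hb⟩ := ((tendsto_cdf_atBot ρ).eventually
      (gt_mem_nhds (Real.exp_pos (-1 / t)))).exists
    refine ⟨b, fun x hx => le_of_not_gt fun hxb => ?_⟩
    exact absurd (hx.trans (monotone_cdf ρ hxb.le)) (not_le.2 hb)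
  refine ⟨fun h => ?_, fun h => csInf_le hbdd h⟩
  -- Right continuity passes the bound from points `z > y` to `y` itself.
  have hr : Tendsto (cdf ρ) (𝓝[>] y) (𝓝 (cdf ρ y)) :=
    ((cdf ρ).right_continuous y).mono_left (nhdsWithin_mono _ Ioi_subset_Ici_self)
  refine ge_of_tendsto hr ?_
  filter_upwards [self_mem_nhdsWithin] with z hz
  obtain ⟨x, hx, hxz⟩ := exists_lt_of_csInf_lt hne (lt_of_le_of_lt h hz)
  exact le_trans hx (monotone_cdf ρ hxz.le)

theorem monotoneOn_tailQuantile (ρ : Measure ℝ) : MonotoneOn (tailQuantile (cdf ρ)) (Ioi 0) := by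
  intro s hs t ht hst
  rw [tailQuantile_le_iff ρ hs]
  refine le_trans (Real.exp_le_exp.2 ?_) ((tailQuantile_le_iff ρ ht _).1 le_rfl)
  rw [neg_div, neg_div, neg_le_neg_iff]
  exact one_div_le_one_div_of_le hs hst

theorem antitoneOn_tailQuantile_div (ρ : Measure ℝ) {t : ℝ} (ht : 0 < t) :
    AntitoneOn (fun s => tailQuantile (cdf ρ) (t / s)) (Ioi 0) := fun _ hr _ hs hrs =>
  monotoneOn_tailQuantile ρ (div_pos ht hs) (div_pos ht hr)
    (div_le_div_of_nonneg_left ht.le hr hrs)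

/-- The exponential distribution of rate `a`, as a measure with density on `(0, ∞)`. -/
noncomputable def expLaw (a : ℝ) : Measure ℝ :=
  (volume.restrict (Ioi 0)).withDensity fun s => ENNReal.ofReal (a * Real.exp (-a * s))

theorem measurable_expLaw_density (a : ℝ) :
    Measurable fun s : ℝ => ENNReal.ofReal (a * Real.exp (-a * s)) := by fun_prop

theorem expLaw_Ici {a : ℝ} (ha : 0 < a) {b : ℝ} (hb : 0 ≤ b) :
    expLaw a (Ici b) = ENNReal.ofReal (Real.exp (-(a * b))) := by
  have hint : IntegrableOn (fun s : ℝ => a * Real.exp (-a * s)) (Ioi b) :=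
    (integrableOn_exp_mul_Ioi (neg_neg_of_pos ha) b).const_mul a
  have hset : (Ici b ∩ Ioi 0 : Set ℝ) =ᵐ[volume] Ioi b := by
    have h : Ioi b = Ioi b ∩ Ioi 0 := by
      rw [Set.inter_eq_left.2 (Ioi_subset_Ioi hb)]
    rw [h]
    exact Ioi_ae_eq_Ici.symm.inter (ae_eq_refl _)
  rw [expLaw, withDensity_apply _ measurableSet_Ici, Measure.restrict_restrict measurableSet_Ici,
    setLIntegral_congr hset, ← ofReal_integral_eq_lintegral_ofReal hint
      (ae_of_all _ fun s => by positivity), integral_const_mul,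
    integral_exp_mul_Ioi (neg_neg_of_pos ha)]
  congr 1
  field_simp

theorem ae_pos_expLaw (a : ℝ) : ∀ᵐ s ∂expLaw a, 0 < s :=
  (withDensity_absolutelyContinuous _ _).ae_le (ae_restrict_mem measurableSet_Ioi)

theorem integral_expLaw {a : ℝ} (ha : 0 ≤ a) (g : ℝ → ℝ) :
    ∫ s, g s ∂expLaw a = ∫ s in Ioi 0, a * Real.exp (-a * s) * g s := by
  rw [expLaw, integral_withDensity_eq_integral_toReal_smul (measurable_expLaw_density a)
    (ae_of_all _ fun _ => ENNReal.ofReal_lt_top)]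
  refine integral_congr_ae (ae_of_all _ fun s => ?_)
  simp only [smul_eq_mul]
  rw [ENNReal.toReal_ofReal (by positivity)]

theorem integrable_expLaw_iff {a : ℝ} (ha : 0 ≤ a) (g : ℝ → ℝ) :
    Integrable g (expLaw a) ↔ IntegrableOn (fun s => a * Real.exp (-a * s) * g s) (Ioi 0) := by
  rw [expLaw, integrable_withDensity_iff_integrable_smul' (measurable_expLaw_density a)
    (ae_of_all _ fun _ => ENNReal.ofReal_lt_top), IntegrableOn]
  refine integrable_congr (ae_of_all _ fun s => ?_)
  simp only [smul_eq_mul]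
  rw [ENNReal.toReal_ofReal (by positivity)]

theorem aemeasurable_tailQuantile_div (ρ : Measure ℝ) {t : ℝ} (ht : 0 < t) (a : ℝ) :
    AEMeasurable (fun s => tailQuantile (cdf ρ) (t / s)) (expLaw a) :=
  (aemeasurable_restrict_of_antitoneOn measurableSet_Ioi
    (antitoneOn_tailQuantile_div ρ ht)).mono_ac (withDensity_absolutelyContinuous _ _)

/-- Quantile transform: if `E` is exponential of rate `m / t`, then `V (t / E)` has distribution
function `F ^ m`. -/
theorem map_expLaw_tailQuantile (ρ : Measure ℝ) {m : ℕ} (hm : 1 ≤ m)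
    (μ : Measure ℝ) [IsProbabilityMeasure μ] (hμ : ∀ y, μ.real (Iic y) = cdf ρ y ^ m)
    {t : ℝ} (ht : 0 < t) :
    (expLaw (m / t)).map (fun s => tailQuantile (cdf ρ) (t / s)) = μ := by
  have hm0 : (0 : ℝ) < m := by exact_mod_cast hm
  symm
  refine Measure.ext_of_Iic _ _ fun y => ?_
  rw [Measure.map_apply_of_aemeasurable (aemeasurable_tailQuantile_div ρ ht _) measurableSet_Iic]
  have hμy : μ (Iic y) = ENNReal.ofReal (cdf ρ y ^ m) := by
    rw [← hμ y, ofReal_measureReal]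
  have key : ∀ s : ℝ, 0 < s →
      (tailQuantile (cdf ρ) (t / s) ≤ y ↔ Real.exp (-(s / t)) ≤ cdf ρ y) := fun s hs => by
    rw [tailQuantile_le_iff ρ (div_pos ht hs), neg_div, one_div_div]
  rw [hμy]
  -- Where the distribution function vanishes its logarithm is a default value; there both sides are
  -- zero.
  rcases (cdf_nonneg ρ y).eq_or_lt with h0 | h0
  · rw [← h0, zero_pow (by omega), ENNReal.ofReal_zero, eq_comm]
    refine measure_mono_null (t := {s | ¬ 0 < s}) (fun s hs hs0 => ?_) (ae_pos_expLaw _)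
    have := (key s hs0).1 hs
    rw [← h0] at this
    exact absurd this (not_le.2 (Real.exp_pos _))
  · have hlog : Real.log (cdf ρ y) ≤ 0 := Real.log_nonpos h0.le (cdf_le_one ρ y)
    have hb : 0 ≤ -(t * Real.log (cdf ρ y)) := by nlinarith
    have hset : ((fun s => tailQuantile (cdf ρ) (t / s)) ⁻¹' Iic y : Set ℝ)
        =ᵐ[expLaw (m / t)] Ici (-(t * Real.log (cdf ρ y))) := by
      filter_upwards [ae_pos_expLaw (m / t)] with s hs
      refine propext ((key s hs).trans ?_)
      rw [← Real.le_log_iff_exp_le h0]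
      change _ ↔ _ ≤ s
      have hst : s / t * t = s := div_mul_cancel₀ s ht.ne'
      constructor <;> intro h <;> nlinarith
    rw [measure_congr hset, expLaw_Ici (by positivity) hb]
    congr 1
    rw [← Real.exp_log (pow_pos h0 m), Real.log_pow]
    congr 1
    field_simp

end HybridHill

/-! ### Limits of the moments of log-excesses. -/

namespace HybridHill

open Set

/-- The `n`-th power of the log-excess of `y` over the threshold `u`, and `0` below it. -/
noncomputable def logExcess (u : ℝ) (n : ℕ) (y : ℝ) : ℝ :=
  if u < y then (Real.log y - Real.log u) ^ n else 0

theorem measurable_logExcess (u : ℝ) (n : ℕ) : Measurable (logExcess u n) :=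
  Measurable.ite measurableSet_Ioi ((Real.measurable_log.sub_const _).pow_const _)
    measurable_const

theorem logExcess_nonneg {u : ℝ} (hu : 0 < u) (n : ℕ) (y : ℝ) : 0 ≤ logExcess u n y := by
  unfold logExcess
  split_ifs with h
  · exact pow_nonneg (sub_nonneg.2 (Real.log_le_log hu h.le)) n
  · exact le_rfl

theorem logExcess_sq (u : ℝ) (n : ℕ) (y : ℝ) :
    logExcess u n y ^ 2 = logExcess u (2 * n) y := by
  unfold logExcess
  split_ifs
  · rw [← pow_mul, mul_comm]
  · simp

/-- A Potter-type bound: A1 with `ε = δ = 1` gives `V (t x) / V t ≤ 2 x ^ (γ + 1)`, whose logarithm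
is below any small power of `x` up to a constant. -/
theorem ConditionA1.log_div_le {V : ℝ → ℝ} {γ : ℝ} (hγ : 0 < γ) (hV : ConditionA1 V γ)
    (hmono : MonotoneOn V (Ioi 0)) {a : ℝ} (ha : 0 < a) :
    ∀ᶠ t in atTop, ∀ x : ℝ, 1 ≤ x →
      Real.log (V (t * x)) - Real.log (V t) ≤ (1 + (γ + 1) / a) * x ^ a := by
  obtain ⟨t₀, ht₀⟩ := hV.uniform_bound 1 1 one_pos one_pos
  filter_upwards [hV.eventually_pos, eventually_ge_atTop t₀, eventually_gt_atTop 0]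
    with t hpos ht h0 x hx
  have hx0 : 0 < x := one_pos.trans_le hx
  have hVx : 0 < V (t * x) :=
    hpos.trans_le (hmono h0 (mul_pos h0 hx0) (le_mul_of_one_le_right h0.le hx))
  have h1 := (abs_le.1 (ht₀ t x ht hx)).2
  have h2 : x ^ γ ≤ x ^ (γ + 1) := Real.rpow_le_rpow_of_exponent_le hx (by linarith)
  have h3 : V (t * x) / V t ≤ 2 * x ^ (γ + 1) := by linarith
  have h4 := Real.log_le_log (div_pos hVx hpos) h3
  rw [Real.log_div hVx.ne' hpos.ne', Real.log_mul two_ne_zero (Real.rpow_pos_of_pos hx0 _).ne',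
    Real.log_rpow hx0] at h4
  have h5 : Real.log x ≤ x ^ a / a := Real.log_le_rpow_div hx0.le ha
  have h6 : 1 ≤ x ^ a := Real.one_le_rpow hx ha.le
  have h7 : Real.log 2 ≤ 1 := by linarith [Real.log_two_lt_d9]
  have h8 : (γ + 1) * Real.log x ≤ (γ + 1) * (x ^ a / a) :=
    mul_le_mul_of_nonneg_left h5 (by linarith)
  calc _ ≤ 1 + (γ + 1) * (x ^ a / a) := by linarith
    _ ≤ x ^ a + (γ + 1) * (x ^ a / a) := by linarith
    _ = _ := by ring

theorem logExcess_tailQuantile_le (ρ : Measure ℝ) {γ : ℝ} (hγ : 0 < γ)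
    (hV : ConditionA1 (tailQuantile (cdf ρ)) γ) (n : ℕ) :
    ∃ g : ℝ → ℝ, IntegrableOn g (Ioi 0) ∧ ∀ᶠ t in atTop, ∀ s, 0 < s →
      logExcess (tailQuantile (cdf ρ) t) n (tailQuantile (cdf ρ) (t / s)) ≤ g s := by
  -- This choice gives `a * n < 1`, so that `s ^ (-(a * n))` is integrable at 0.
  set a : ℝ := 1 / (n + 1) with ha_def
  have ha : 0 < a := by positivity
  have han : a * n < 1 := by
    rw [ha_def, one_div, ← div_eq_inv_mul, div_lt_one (by positivity)]; linarith
  refine ⟨(Ioo 0 1).indicator fun s => (1 + (γ + 1) / a) ^ n * s ^ (-(a * n)), ?_, ?_⟩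
  · refine Integrable.integrableOn ?_
    rw [integrable_indicator_iff measurableSet_Ioo]
    exact ((intervalIntegral.integrableOn_Ioo_rpow_iff one_pos).2 (by linarith)).const_mul _
  filter_upwards [hV.log_div_le hγ (monotoneOn_tailQuantile ρ) ha, eventually_gt_atTop 0,
    hV.eventually_pos] with t hle ht hpos s hs
  unfold logExcess
  by_cases hs1 : s < 1
  · rw [indicator_of_mem (show s ∈ Ioo (0 : ℝ) 1 from ⟨hs, hs1⟩)]
    have hK : 0 ≤ 1 + (γ + 1) / a := by positivity
    split_ifs with h
    · have h1 := hle s⁻¹ ((one_le_inv₀ hs).2 hs1.le)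
      rw [← div_eq_mul_inv] at h1
      refine (pow_le_pow_left₀ (sub_nonneg.2 (Real.log_le_log hpos h.le)) h1 n).trans_eq ?_
      rw [mul_pow, ← Real.rpow_natCast (s⁻¹ ^ a), ← Real.rpow_mul (inv_nonneg.2 hs.le),
        Real.inv_rpow hs.le, Real.rpow_neg hs.le]
    · positivity
  · rw [indicator_of_notMem fun h => hs1 h.2, if_neg]
    rw [not_lt] at hs1 ⊢
    exact monotoneOn_tailQuantile ρ (div_pos ht hs) ht (div_le_self ht.le hs1)

theorem tendsto_logExcess_tailQuantile (ρ : Measure ℝ) {γ : ℝ} (hγ : 0 < γ)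
    (hV : ConditionA1 (tailQuantile (cdf ρ)) γ) (n : ℕ) {s : ℝ} (hs : 0 < s) :
    Tendsto (fun t => logExcess (tailQuantile (cdf ρ) t) n (tailQuantile (cdf ρ) (t / s))) atTop
      (𝓝 ((Ioo 0 1).indicator (fun s => (-(γ * Real.log s)) ^ n) s)) := by
  by_cases hs1 : s < 1
  · rw [indicator_of_mem (show s ∈ Ioo (0 : ℝ) 1 from ⟨hs, hs1⟩)]
    have h := hV.tendsto_log s⁻¹ (inv_pos.2 hs)
    rw [Real.log_inv, mul_neg] at h
    refine (h.pow n).congr' ?_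
    have hpos : 0 < -(γ * Real.log s) := by nlinarith [Real.log_neg hs hs1]
    filter_upwards [h.eventually (lt_mem_nhds hpos), hV.eventually_pos, eventually_gt_atTop 0]
      with t ht hVt ht0
    rw [← div_eq_mul_inv] at ht ⊢
    have hle : tailQuantile (cdf ρ) t ≤ tailQuantile (cdf ρ) (t / s) :=
      monotoneOn_tailQuantile ρ ht0 (div_pos ht0 hs) (by
        rw [le_div_iff₀ hs]; nlinarith)
    -- Equality would make the log-difference 0, against its positive limit. Strictness matters for
    -- `n = 0`, where the indicator itself must converge.
    have hlt : tailQuantile (cdf ρ) t < tailQuantile (cdf ρ) (t / s) :=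
      hle.lt_of_ne fun h => by rw [h] at ht; simp at ht
    rw [logExcess, if_pos hlt]
  · rw [indicator_of_notMem fun h => hs1 h.2]
    refine tendsto_const_nhds.congr' ?_
    filter_upwards [eventually_gt_atTop 0] with t ht
    rw [logExcess, if_neg]
    rw [not_lt] at hs1 ⊢
    exact monotoneOn_tailQuantile ρ (div_pos ht hs) ht (div_le_self ht.le hs1)

/-- Under the quantile transform the scaled moment is the integral of `exp (-(m / t) s)` times the
log-excess of `V (t / s)` over `V t`; the factor `t / m` cancels the rate in the density. -/
theorem logExcess_moments (ρ : Measure ℝ) {γ : ℝ} (hγ : 0 < γ)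
    (hV : ConditionA1 (tailQuantile (cdf ρ)) γ) {m : ℕ} (hm : 1 ≤ m)
    (μ : Measure ℝ) [IsProbabilityMeasure μ] (hμ : ∀ y, μ.real (Iic y) = cdf ρ y ^ m) (n : ℕ) :
    (∀ᶠ t in atTop, Integrable (logExcess (tailQuantile (cdf ρ) t) n) μ) ∧
      Tendsto (fun t => t / m * ∫ y, logExcess (tailQuantile (cdf ρ) t) n y ∂μ) atTop
        (𝓝 (∫ s in Ioo 0 1, (-(γ * Real.log s)) ^ n)) := by
  have hm0 : (0 : ℝ) < m := by exact_mod_cast hm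
  set V := tailQuantile (cdf ρ) with hVdef
  obtain ⟨g, hg, hgle⟩ := logExcess_tailQuantile_le ρ hγ hV n
  set G : ℝ → ℝ → ℝ := fun t s => Real.exp (-(m / t) * s) * logExcess (V t) n (V (t / s)) with hG
  have hmeas : ∀ᶠ t in atTop, AEStronglyMeasurable (G t) (volume.restrict (Ioi 0)) := by
    filter_upwards [eventually_gt_atTop 0] with t ht
    refine AEStronglyMeasurable.mul (by fun_prop) ?_
    exact ((measurable_logExcess (V t) n).comp_aemeasurable (aemeasurable_restrict_of_antitoneOn
      measurableSet_Ioi (antitoneOn_tailQuantile_div ρ ht))).aestronglyMeasurable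
  have hbound : ∀ᶠ t in atTop, ∀ᵐ s ∂volume.restrict (Ioi 0), ‖G t s‖ ≤ g s := by
    filter_upwards [hgle, eventually_gt_atTop 0, hV.eventually_pos] with t hle ht hpos
    refine (ae_restrict_mem measurableSet_Ioi).mono fun s (hs : 0 < s) => ?_
    have h1 : Real.exp (-(m / t) * s) ≤ 1 := Real.exp_le_one_iff.2 (by
      have : 0 ≤ m / t * s := by positivity
      linarith)
    have h2 := logExcess_nonneg hpos n (V (t / s))
    rw [Real.norm_of_nonneg (mul_nonneg (Real.exp_nonneg _) h2)]
    exact (mul_le_of_le_one_left h2 h1).trans (hle s hs)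
  have hlim : ∀ᵐ s ∂volume.restrict (Ioi 0), Tendsto (fun t => G t s) atTop
      (𝓝 ((Ioo 0 1).indicator (fun s => (-(γ * Real.log s)) ^ n) s)) := by
    refine (ae_restrict_mem measurableSet_Ioi).mono fun s (hs : 0 < s) => ?_
    have h1 : Tendsto (fun t : ℝ => Real.exp (-(m / t) * s)) atTop (𝓝 1) := by
      rw [← Real.exp_zero]
      have h : Tendsto (fun t : ℝ => -(m / t) * s) atTop (𝓝 0) := by
        simpa using ((tendsto_const_nhds (x := (m : ℝ))).div_atTop tendsto_id).neg.mul_const s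
      exact (Real.continuous_exp.tendsto 0).comp h
    simpa only [one_mul] using h1.mul (tendsto_logExcess_tailQuantile ρ hγ hV n hs)
  have hT := tendsto_integral_filter_of_dominated_convergence g hmeas hbound hg hlim
  rw [setIntegral_indicator measurableSet_Ioo,
    inter_eq_right.2 (Ioo_subset_Ioi_self : Ioo (0 : ℝ) 1 ⊆ Ioi 0)] at hT
  constructor
  · filter_upwards [hmeas, hbound, eventually_gt_atTop 0] with t h1 h2 ht
    rw [← map_expLaw_tailQuantile ρ hm μ hμ ht, integrable_map_measure
      (measurable_logExcess _ _).aestronglyMeasurable (aemeasurable_tailQuantile_div ρ ht _),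
      integrable_expLaw_iff (by positivity)]
    refine ((Integrable.mono' hg h1 h2).const_mul (m / t)).congr (ae_of_all _ fun s => ?_)
    simp only [hG, Function.comp_apply, ← hVdef]
    ring
  · refine hT.congr' ?_
    filter_upwards [eventually_gt_atTop 0] with t ht
    conv_rhs => rw [← map_expLaw_tailQuantile ρ hm μ hμ ht]
    rw [integral_map (aemeasurable_tailQuantile_div ρ ht _)
      (measurable_logExcess _ _).aestronglyMeasurable, integral_expLaw (by positivity),
      ← integral_const_mul]
    refine integral_congr_ae (ae_of_all _ fun s => ?_)
    simp only [hG, ← hVdef]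
    field_simp

theorem integral_Ioo_neg_mul_log (γ : ℝ) : ∫ s in Ioo (0 : ℝ) 1, (-(γ * Real.log s)) = γ := by
  rw [← integral_Ioc_eq_integral_Ioo, ← intervalIntegral.integral_of_le zero_le_one,
    intervalIntegral.integral_neg, intervalIntegral.integral_const_mul, integral_log]
  simp

end HybridHill

/-! ### Order statistics and comparison of thresholds. -/

namespace HybridHill

open Finset

theorem orderStat_sub {k : ℕ} (v : Fin k → ℝ) {i : ℕ} (hi : i < k) :
    orderStat v (k - i) = v (Tuple.sort v ⟨k - 1 - i, by omega⟩) := by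
  rw [orderStat, dif_pos ⟨by omega, by omega⟩]
  congr 3
  omega

theorem sum_range_orderStat {k k₀ : ℕ} (h : k₀ < k) (v : Fin k → ℝ) (f : ℝ → ℝ) :
    ∑ i ∈ range k₀, f (orderStat v (k - i)) =
      ∑ j ∈ univ.filter fun j : Fin k => k - k₀ ≤ (j : ℕ), f (v (Tuple.sort v j)) := by
  refine Finset.sum_bij (fun i hi => ⟨k - 1 - i, by have := mem_range.1 hi; omega⟩) ?_ ?_ ?_ ?_
  · intro i hi
    have := mem_range.1 hi
    simp only [mem_filter, mem_univ, true_and]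
    omega
  · intro i hi j hj hij
    have h1 := mem_range.1 hi
    have h2 := mem_range.1 hj
    have := Fin.mk.inj_iff.1 hij
    omega
  · intro j hj
    have hj' := (mem_filter.1 hj).2
    have := j.2
    exact ⟨k - 1 - j, mem_range.2 (by omega), Fin.ext (by simp only []; omega)⟩
  · intro i hi
    rw [orderStat_sub v ((mem_range.1 hi).trans h)]

theorem sum_logExcess_eq {k : ℕ} (v : Fin k → ℝ) (u : ℝ) (n : ℕ) :
    ∑ i, logExcess u n (v i) =
      ∑ j with u < v (Tuple.sort v j), (Real.log (v (Tuple.sort v j)) - Real.log u) ^ n := by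
  rw [← Equiv.sum_comp (Tuple.sort v), sum_filter]
  rfl

theorem card_filter_fin_ge (k a : ℕ) : #{j : Fin k | a ≤ (j : ℕ)} = k - a := by
  have : #{j : Fin k | a ≤ (j : ℕ)} = #(Finset.Ico a k) := by
    refine Finset.card_bij (fun j _ => (j : ℕ)) ?_ ?_ ?_
    · intro j hj; exact Finset.mem_Ico.2 ⟨(mem_filter.1 hj).2, j.2⟩
    · intro i _ j _ hij; exact Fin.ext hij
    · intro b hb
      have := Finset.mem_Ico.1 hb
      exact ⟨⟨b, this.2⟩, by simpa using this.1, rfl⟩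
  rw [this, Nat.card_Ico]

/-- With exponent 0 the sum counts exceedances, and `orderStat v (k - k₀)` is the `(k₀ + 1)`-th
largest value, hence the strict inequality. -/
theorem lt_orderStat_iff {k k₀ : ℕ} (h : k₀ < k) (v : Fin k → ℝ) (u : ℝ) :
    u < orderStat v (k - k₀) ↔ (k₀ : ℝ) < ∑ i, logExcess u 0 (v i) := by
  have hmono : Monotone (v ∘ Tuple.sort v) := Tuple.monotone_sort v
  rw [sum_logExcess_eq, orderStat_sub v h]
  simp only [pow_zero, sum_const, nsmul_eq_mul, mul_one, Nat.cast_lt]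
  constructor
  · intro hu
    have hsub : ({j : Fin k | k - 1 - k₀ ≤ (j : ℕ)} : Finset (Fin k)) ⊆
        ({j | u < v (Tuple.sort v j)} : Finset (Fin k)) := fun j hj => by
      simp only [mem_filter, mem_univ, true_and] at hj ⊢
      exact hu.trans_le (hmono (show (⟨k - 1 - k₀, by omega⟩ : Fin k) ≤ j from hj))
    have := card_le_card hsub
    rw [card_filter_fin_ge] at this
    omega
  · intro hc
    by_contra hu
    rw [not_lt] at hu
    have hsub : ({j | u < v (Tuple.sort v j)} : Finset (Fin k)) ⊆
        ({j : Fin k | k - k₀ ≤ (j : ℕ)} : Finset (Fin k)) := fun j hj => by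
      simp only [mem_filter, mem_univ, true_and] at hj ⊢
      by_contra hlt
      have : j ≤ (⟨k - 1 - k₀, by omega⟩ : Fin k) := by
        change (j : ℕ) ≤ k - 1 - k₀
        omega
      exact absurd ((hmono this).trans hu) (not_le.2 hj)
    have := card_le_card hsub
    rw [card_filter_fin_ge] at this
    omega

theorem orderStat_sub_le {k k₀ : ℕ} (h : k₀ < k) (v : Fin k → ℝ) {j : Fin k}
    (hj : k - k₀ ≤ (j : ℕ)) : orderStat v (k - k₀) ≤ v (Tuple.sort v j) := by
  rw [orderStat_sub v h]
  refine Tuple.monotone_sort v (show (⟨k - 1 - k₀, by omega⟩ : Fin k) ≤ j from ?_)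
  change k - 1 - k₀ ≤ (j : ℕ)
  omega

/-- The Hill estimator is at most the mean log-excess over a threshold below its own. -/
theorem hill_le {k k₀ : ℕ} (h : k₀ < k) (v : Fin k → ℝ) {u : ℝ} (hu : 0 < u)
    (huT : u < orderStat v (k - k₀)) :
    hill v k₀ ≤ 1 / (k₀ : ℝ) * ∑ i, logExcess u 1 (v i) := by
  refine mul_le_mul_of_nonneg_left ?_ (by positivity)
  rw [sum_range_orderStat h v fun y => Real.log y - Real.log (orderStat v (k - k₀)),
    sum_logExcess_eq]
  simp only [pow_one]
  -- Lowering the threshold enlarges each term; the further exceedances of `u` then add non-negative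
  -- terms.
  refine (sum_le_sum fun j _ => sub_le_sub_left (Real.log_le_log hu huT.le)
    (Real.log (v (Tuple.sort v j)))).trans ?_
  refine sum_le_sum_of_subset_of_nonneg (fun j hj => ?_) fun j hj _ => ?_
  · exact mem_filter.2 ⟨mem_univ _, huT.trans_le (orderStat_sub_le h v (mem_filter.1 hj).2)⟩
  · exact sub_nonneg.2 (Real.log_le_log hu (mem_filter.1 hj).2.le)

/-- The Hill estimator is at least the mean log-excess over a threshold above its own. -/
theorem le_hill {k k₀ : ℕ} (h : k₀ < k) (v : Fin k → ℝ) {u : ℝ}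
    (hT : 0 < orderStat v (k - k₀)) (huT : orderStat v (k - k₀) ≤ u) :
    1 / (k₀ : ℝ) * ∑ i, logExcess u 1 (v i) ≤ hill v k₀ := by
  refine mul_le_mul_of_nonneg_left ?_ (by positivity)
  rw [sum_range_orderStat h v fun y => Real.log y - Real.log (orderStat v (k - k₀)),
    sum_logExcess_eq]
  simp only [pow_one]
  refine (sum_le_sum fun j _ => sub_le_sub_left (Real.log_le_log hT huT)
    (Real.log (v (Tuple.sort v j)))).trans ?_
  -- Every value above `u` is among the top `k₀`; the remaining top values add non-negative terms.
  refine sum_le_sum_of_subset_of_nonneg (fun j hj => ?_) fun j hj _ => ?_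
  · refine mem_filter.2 ⟨mem_univ _, ?_⟩
    have hj' := (mem_filter.1 hj).2
    by_contra hlt
    have hle : j ≤ (⟨k - 1 - k₀, by omega⟩ : Fin k) := by
      change (j : ℕ) ≤ k - 1 - k₀
      omega
    have := Tuple.monotone_sort v hle
    rw [Function.comp_apply, Function.comp_apply, ← orderStat_sub v h] at this
    exact absurd (this.trans huT) (not_le.2 hj')
  · exact sub_nonneg.2 (Real.log_le_log hT (orderStat_sub_le h v (mem_filter.1 hj).2))

end HybridHill

/-! ### Block maxima and a weak law of large numbers. -/

namespace HybridHill

open Finset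

theorem blockMax_le_iff {Ω : Type*} (X : ℕ → Ω → ℝ) {m : ℕ} (hm : 1 ≤ m) (i : ℕ) (w : Ω) (y : ℝ) :
    blockMax X m i w ≤ y ↔ ∀ j : Fin m, X (i * m + j) w ≤ y := by
  have : Nonempty (Fin m) := ⟨⟨0, hm⟩⟩
  exact ciSup_le_iff (Set.finite_range _).bddAbove

variable {Ω : Type*} [MeasurableSpace Ω] {P : Measure Ω}

theorem measurable_blockMax {X : ℕ → Ω → ℝ} (hX : ∀ j, Measurable (X j)) (m i : ℕ) :
    Measurable (blockMax X m i) :=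
  Measurable.iSup fun j : Fin m => hX (i * m + j)

theorem measureReal_blockMax_le {X : ℕ → Ω → ℝ} (hindep : iIndepFun X P) {F : ℝ → ℝ}
    (hF : ∀ j x, P.real {w | X j w ≤ x} = F x) {m : ℕ} (hm : 1 ≤ m) (i : ℕ) (y : ℝ) :
    P.real {w | blockMax X m i w ≤ y} = F y ^ m := by
  have hinj : Function.Injective fun j : Fin m => i * m + (j : ℕ) := fun a b h =>
    Fin.ext (Nat.add_left_cancel h)
  have h := (hindep.precomp hinj).measure_inter_preimage_eq_mul univ
    (sets := fun _ => Set.Iic y) fun _ _ => measurableSet_Iic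
  have hset : {w | blockMax X m i w ≤ y} =
      ⋂ j ∈ (univ : Finset (Fin m)), X (i * m + j) ⁻¹' Set.Iic y := by
    ext w
    simp [blockMax_le_iff X hm]
  rw [hset, measureReal_def]
  refine (congrArg ENNReal.toReal h).trans ?_
  rw [ENNReal.toReal_prod]
  refine (prod_congr rfl fun (j : Fin m) _ => hF (i * m + j) y).trans ?_
  simp

/-- Distinct blocks use disjoint index sets. Pairwise independence suffices for the variance of a
sum. -/
theorem indepFun_blockMax {X : ℕ → Ω → ℝ} (hX : ∀ j, Measurable (X j)) (hindep : iIndepFun X P)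
    (m : ℕ) {i j : ℕ} (hij : i ≠ j) : blockMax X m i ⟂ᵢ[P] blockMax X m j := by
  have hmem : ∀ i (l : Fin m), i * m + (l : ℕ) ∈ Ico (i * m) ((i + 1) * m) := fun i l => by
    rw [Finset.mem_Ico, add_mul, one_mul]
    have := l.2
    omega
  have hdisj : Disjoint (Ico (i * m) ((i + 1) * m)) (Ico (j * m) ((j + 1) * m)) := by
    rw [Finset.disjoint_left]
    intro a ha hb
    rw [Finset.mem_Ico] at ha hb
    rcases hij.lt_or_gt with h | h
    · have := Nat.mul_le_mul_right m (Nat.add_one_le_iff.2 h)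
      omega
    · have := Nat.mul_le_mul_right m (Nat.add_one_le_iff.2 h)
      omega
  have hφ : ∀ i, Measurable fun a : Ico (i * m) ((i + 1) * m) → ℝ =>
      ⨆ l : Fin m, a ⟨i * m + l, hmem i l⟩ := fun i =>
    Measurable.iSup fun l => measurable_pi_apply _
  exact (hindep.indepFun_finset _ _ hdisj hX).comp (hφ i) (hφ j)

/-- Chebyshev's inequality for a sum of functions of pairwise independent, identically distributed
random variables. -/
theorem measure_abs_sum_sub_le [IsProbabilityMeasure P] {Y : ℕ → Ω → ℝ}
    (hY : ∀ i, Measurable (Y i)) (hindep : Pairwise fun i j => Y i ⟂ᵢ[P] Y j) {μ : Measure ℝ}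
    (hlaw : ∀ i, P.map (Y i) = μ) {g : ℝ → ℝ} (hg : Measurable g)
    (hg2 : Integrable (fun y => g y ^ 2) μ) (k : ℕ) {b ε : ℝ} (hb : 0 < b) (hε : 0 < ε) :
    P {w | ε ≤ |1 / b * ∑ i : Fin k, g (Y i w) - k / b * ∫ y, g y ∂μ|} ≤
      ENNReal.ofReal (k * ∫ y, g y ^ 2 ∂μ) / ENNReal.ofReal ((b * ε) ^ 2) := by
  have hL : ∀ i, MemLp (fun w => g (Y i w)) 2 P := fun i => by
    refine (memLp_two_iff_integrable_sq (hg.comp (hY i)).aestronglyMeasurable).2 ?_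
    rw [← hlaw i] at hg2
    exact hg2.comp_measurable (hY i)
  have hint : ∀ i, ∫ w, g (Y i w) ∂P = ∫ y, g y ∂μ := fun i => by
    rw [← hlaw i, integral_map (hY i).aemeasurable hg.aestronglyMeasurable]
  have hvar : ∀ i, Var[fun w => g (Y i w); P] ≤ ∫ y, g y ^ 2 ∂μ := fun i => by
    refine (variance_le_expectation_sq (hg.comp (hY i)).aestronglyMeasurable).trans_eq ?_
    rw [← hlaw i, integral_map (hY i).aemeasurable (hg.pow_const 2).aestronglyMeasurable]
    rfl
  set S : Ω → ℝ := ∑ i : Fin k, fun w => g (Y i w) with hS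
  have hSL : MemLp S 2 P := memLp_finsetSum' _ fun i _ => hL i
  have hSint : ∫ w, S w ∂P = k * ∫ y, g y ∂μ := by
    simp only [hS, Finset.sum_apply]
    rw [integral_finsetSum _ fun (i : Fin k) _ => (hL i).integrable one_le_two]
    simp [hint]
  have hSvar : Var[S; P] ≤ k * ∫ y, g y ^ 2 ∂μ := by
    rw [hS, IndepFun.variance_sum (X := fun (i : Fin k) w => g (Y i w)) (fun i _ => hL i)
      fun i _ j _ hij => (hindep fun h : (i : ℕ) = j => hij (Fin.ext h)).comp hg hg]
    refine (sum_le_sum fun (i : Fin k) _ => hvar i).trans_eq ?_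
    simp
  rw [← ENNReal.ofReal_div_of_pos (by positivity)]
  refine (measure_mono fun w hw => ?_).trans ((meas_ge_le_variance_div_sq hSL
    (mul_pos hb hε)).trans (ENNReal.ofReal_le_ofReal (by gcongr)))
  rw [Set.mem_ofPred_eq] at hw ⊢
  rw [hSint, hS, Finset.sum_apply]
  have h1 : (∑ i : Fin k, g (Y i w)) - k * ∫ y, g y ∂μ =
      b * (1 / b * ∑ i : Fin k, g (Y i w) - k / b * ∫ y, g y ∂μ) := by
    field_simp
  rw [h1, abs_mul, abs_of_pos hb]
  exact mul_le_mul_of_nonneg_left hw hb.le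

/-- Law of large numbers for the log-excesses over the threshold `V (c m k / k₀)`. -/
theorem tendsto_measure_sum_logExcess [IsProbabilityMeasure P] {Y : ℕ → Ω → ℝ}
    (hY : ∀ i, Measurable (Y i)) (hindep : Pairwise fun i j => Y i ⟂ᵢ[P] Y j) {μ : Measure ℝ}
    (hlaw : ∀ i, P.map (Y i) = μ) {V : ℝ → ℝ} {m : ℕ} (hm : 1 ≤ m) {n : ℕ} {L L₂ : ℝ}
    (hint : ∀ᶠ t in atTop, Integrable (logExcess (V t) (2 * n)) μ)
    (hL : Tendsto (fun t => t / m * ∫ y, logExcess (V t) n y ∂μ) atTop (𝓝 L))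
    (hL₂ : Tendsto (fun t => t / m * ∫ y, logExcess (V t) (2 * n) y ∂μ) atTop (𝓝 L₂))
    {k₀ : ℕ → ℕ} (hk₀ : Tendsto k₀ atTop atTop)
    (hk : Tendsto (fun k : ℕ => (k : ℝ) / k₀ k) atTop atTop) {c : ℝ} (hc : 0 < c)
    {ε : ℝ} (hε : 0 < ε) :
    Tendsto (fun k : ℕ => P {w | ε ≤ |1 / (k₀ k : ℝ) *
      ∑ i : Fin k, logExcess (V (c * m * (k / k₀ k))) n (Y i w) - L / c|}) atTop (𝓝 0) := by
  have hm0 : (0 : ℝ) < m := by exact_mod_cast hm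
  have ht : Tendsto (fun k : ℕ => c * m * ((k : ℝ) / k₀ k)) atTop atTop :=
    hk.const_mul_atTop (mul_pos hc hm0)
  -- At `t = c m k / k₀` the factor `k / k₀` equals `(t / m) / c`.
  have hmean : ∀ {n : ℕ} {L : ℝ},
      Tendsto (fun t => t / m * ∫ y, logExcess (V t) n y ∂μ) atTop (𝓝 L) →
      Tendsto (fun k : ℕ => (k : ℝ) / k₀ k * ∫ y, logExcess (V (c * m * (k / k₀ k))) n y ∂μ) atTop
        (𝓝 (L / c)) := fun {n L} h => by
    refine ((h.comp ht).div_const c).congr fun k => ?_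
    simp only [Function.comp_apply]
    field_simp
  have hk₀' : Tendsto (fun k => (k₀ k : ℝ)) atTop atTop := tendsto_natCast_atTop_atTop.comp hk₀
  -- The Chebyshev bound is a convergent second-moment term times an extra `1 / k₀`. Half of `ε` is
  -- left for the bias of the mean.
  have hbound : Tendsto (fun k : ℕ => ENNReal.ofReal
      ((k : ℝ) / k₀ k * (∫ y, logExcess (V (c * m * (k / k₀ k))) (2 * n) y ∂μ) *
        (k₀ k : ℝ)⁻¹ * ((ε / 2) ^ 2)⁻¹)) atTop (𝓝 0) := by
    have := ((hmean hL₂).mul (tendsto_inv_atTop_zero.comp hk₀')).mul_const ((ε / 2) ^ 2)⁻¹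
    rw [mul_zero, zero_mul] at this
    simpa using ENNReal.tendsto_ofReal this
  refine tendsto_of_tendsto_of_tendsto_of_le_of_le' tendsto_const_nhds hbound
    (Eventually.of_forall fun _ => zero_le) ?_
  filter_upwards [ht.eventually hint, (hmean hL).eventually (Metric.ball_mem_nhds _ (half_pos hε)),
    hk₀'.eventually_gt_atTop 0] with k h1 h2 h3
  have hsq : Integrable (fun y => logExcess (V (c * m * (k / k₀ k))) n y ^ 2) μ := by
    simpa only [logExcess_sq] using h1
  have := measure_abs_sum_sub_le hY hindep hlaw
    (measurable_logExcess (V (c * m * (k / k₀ k))) n) hsq k h3 (half_pos hε)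
  refine (measure_mono fun w hw => ?_).trans (this.trans_eq ?_)
  · rw [Set.mem_ofPred_eq] at hw ⊢
    rw [Real.dist_eq] at h2
    have := abs_sub_le (1 / (k₀ k : ℝ) *
      ∑ i : Fin k, logExcess (V (c * m * (k / k₀ k))) n (Y i w))
      (k / k₀ k * ∫ y, logExcess (V (c * m * (k / k₀ k))) n y ∂μ) (L / c)
    linarith
  · simp only [logExcess_sq]
    rw [← ENNReal.ofReal_div_of_pos (by positivity)]
    congr 1
    field_simp

end HybridHill

/-! ### Growth of `k / k₀`, enclosure and conclusion. -/

namespace HybridHill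

/-- The condition on `ϑ` forces `ϑ k ≥ 1` eventually, so `k₀ ≤ √k` and `k / k₀ ≥ √k`. -/
theorem tendsto_div_atTop_of_hybrid {ϑ : ℕ → ℝ} (hϑ_pos : ∀ k, 1 ≤ k → 0 < ϑ k)
    (hϑ : Tendsto (fun k : ℕ => √(k : ℝ) * ϑ k ^ (-3 : ℤ)) atTop (𝓝 0))
    {k₀ : ℕ → ℕ} (hk₀ : Tendsto k₀ atTop atTop)
    (hk₀ϑ : (fun k : ℕ => ϑ k * (k₀ k : ℝ)) =o[atTop] (fun k : ℕ => √(k : ℝ))) :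
    Tendsto (fun k : ℕ => (k : ℝ) / k₀ k) atTop atTop := by
  have hsqrt : Tendsto (fun k : ℕ => √(k : ℝ)) atTop atTop :=
    Real.tendsto_sqrt_atTop.comp tendsto_natCast_atTop_atTop
  refine tendsto_atTop_mono' _ ?_ hsqrt
  filter_upwards [hϑ.eventually (gt_mem_nhds one_pos), hk₀ϑ.bound one_pos,
    hk₀.eventually_gt_atTop 0, eventually_ge_atTop 1] with k h1 h2 h3 hk
  have hp := hϑ_pos k hk
  have hk' : (1 : ℝ) ≤ k := by exact_mod_cast hk
  have h3' : (0 : ℝ) < k₀ k := by exact_mod_cast h3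
  have hs : 1 ≤ √(k : ℝ) := Real.one_le_sqrt.2 hk'
  have hϑ1 : 1 ≤ ϑ k := by
    rw [zpow_neg, ← div_eq_mul_inv, div_lt_one (by positivity)] at h1
    by_contra hlt
    have h4 : ϑ k ^ (3 : ℤ) ≤ 1 := by
      exact_mod_cast pow_le_one₀ (n := 3) hp.le (not_le.1 hlt).le
    exact absurd (h1.trans_le h4) (not_lt.2 hs)
  rw [Real.norm_of_nonneg (by positivity), Real.norm_of_nonneg (by positivity), one_mul] at h2
  rw [le_div_iff₀ h3']
  calc √(k : ℝ) * k₀ k ≤ √(k : ℝ) * √(k : ℝ) :=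
        mul_le_mul_of_nonneg_left ((le_mul_of_one_le_left h3'.le hϑ1).trans h2) (by positivity)
    _ = k := Real.mul_self_sqrt (by positivity)

/-- If the numbers of exceedances of the two thresholds `u < u'` lie on either side of `k₀`, the
Hill estimator is enclosed by the two mean log-excesses. -/
theorem hill_mem_Icc {k k₀ : ℕ} (h₀ : 0 < k₀) (h : k₀ < k) (v : Fin k → ℝ) {u u' : ℝ} (hu : 0 < u)
    (h1 : 1 < 1 / (k₀ : ℝ) * ∑ i, logExcess u 0 (v i))
    (h2 : 1 / (k₀ : ℝ) * ∑ i, logExcess u' 0 (v i) ≤ 1) :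
    hill v k₀ ∈ Set.Icc (1 / (k₀ : ℝ) * ∑ i, logExcess u' 1 (v i))
      (1 / (k₀ : ℝ) * ∑ i, logExcess u 1 (v i)) := by
  have h₀' : (0 : ℝ) < k₀ := by exact_mod_cast h₀
  rw [one_div_mul_eq_div, one_lt_div h₀'] at h1
  rw [one_div_mul_eq_div, div_le_one h₀'] at h2
  have hT := (lt_orderStat_iff h v u).2 h1
  have hT' := not_lt.1 (mt (lt_orderStat_iff h v u').1 (not_lt.2 h2))
  exact ⟨le_hill h v (hu.trans hT) hT', hill_le h v hu hT⟩

end HybridHill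

theorem mainTheorem2 {Ω : Type*} [MeasurableSpace Ω] (P : Measure Ω) [IsProbabilityMeasure P]
    (X : ℕ → Ω → ℝ) (hX_meas : ∀ j, Measurable (X j)) (hX_indep : iIndepFun X P)
    (F : ℝ → ℝ) (hX_df : ∀ j x, P.real {w | X j w ≤ x} = F x)
    (γ : ℝ) (hγ : 0 < γ)
    (m : ℕ) (hm : 1 ≤ m) (hB : HybridHill.ConditionB F m γ)
    (ϑ : ℕ → ℝ) (hϑ_pos : ∀ k, 1 ≤ k → 0 < ϑ k)
    (hϑ : Tendsto (fun k : ℕ => √(k : ℝ) * ϑ k ^ (-3 : ℤ)) atTop (𝓝 0))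
    (k₀ : ℕ → ℕ) (hk₀ : Tendsto k₀ atTop atTop)
    (hk₀ϑ : (fun k : ℕ => ϑ k * (k₀ k : ℝ)) =o[atTop] (fun k : ℕ => √(k : ℝ))) :
    TendstoInMeasure P (fun (k : ℕ) (w : Ω) => HybridHill.hybridHill X m (k₀ k) k w) atTop
      (fun _ => γ) := by
  open HybridHill in
  have hk := tendsto_div_atTop_of_hybrid hϑ_pos hϑ hk₀ hk₀ϑ
  set ρ : Measure ℝ := P.map (X 0) with hρ
  have : IsProbabilityMeasure ρ := Measure.isProbabilityMeasure_map (hX_meas 0).aemeasurable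
  have hF : F = cdf ρ := by
    funext x
    rw [cdf_eq_real, hρ, map_measureReal_apply (hX_meas 0) measurableSet_Iic, ← hX_df 0 x]
    rfl
  have hA := hB.conditionA1
  rw [hF] at hA
  have hY := measurable_blockMax hX_meas m
  have hYindep : Pairwise fun i j => blockMax X m i ⟂ᵢ[P] blockMax X m j := fun i j hij =>
    indepFun_blockMax hX_meas hX_indep m hij
  have hYdf : ∀ i y, (P.map (blockMax X m i)).real (Set.Iic y) = cdf ρ y ^ m := fun i y => by
    rw [map_measureReal_apply (hY i) measurableSet_Iic, ← hF,
      ← measureReal_blockMax_le hX_indep hX_df hm i y]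
    rfl
  set μ := P.map (blockMax X m 0) with hμ
  have : IsProbabilityMeasure μ := Measure.isProbabilityMeasure_map (hY 0).aemeasurable
  have hlaw : ∀ i, P.map (blockMax X m i) = μ := fun i => by
    have : IsProbabilityMeasure (P.map (blockMax X m i)) :=
      Measure.isProbabilityMeasure_map (hY i).aemeasurable
    refine Measure.ext_of_Iic _ _ fun y => ?_
    rw [← ofReal_measureReal, ← ofReal_measureReal (μ := μ), hYdf, hYdf]
  have hmom := logExcess_moments ρ hγ hA hm μ (hYdf 0)
  have hL0 := (hmom 0).2
  have hL1 := (hmom 1).2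
  simp only [pow_zero, integral_const, MeasurableSet.univ, measureReal_restrict_apply,
    Set.univ_inter, Real.volume_real_Ioo, sub_zero, max_eq_left zero_le_one, smul_eq_mul,
    mul_one] at hL0
  simp only [pow_one, integral_Ioo_neg_mul_log] at hL1
  have hlln0 : ∀ {c : ℝ}, 0 < c → ∀ {ε : ℝ}, 0 < ε → _ := fun hc _ hε =>
    tendsto_measure_sum_logExcess hY hYindep hlaw hm (n := 0) (hmom 0).1 hL0 (hmom 0).2 hk₀ hk hc hε
  -- Only the existence of a finite limit of the second moments is needed, so the value for `n = 2`
  -- is not computed.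
  have hlln1 : ∀ {c : ℝ}, 0 < c → ∀ {ε : ℝ}, 0 < ε → _ := fun hc _ hε =>
    tendsto_measure_sum_logExcess hY hYindep hlaw hm (n := 1) (hmom 2).1 hL1 (hmom 2).2 hk₀ hk hc hε
  rw [tendstoInMeasure_iff_dist]
  intro ε hε
  obtain ⟨c, c', hc, hc1, hc1', h1, h2⟩ : ∃ c c' : ℝ, 0 < c ∧ c < 1 ∧ 1 < c' ∧
      γ / c < γ + ε / 2 ∧ γ - ε / 2 < γ / c' := by
    -- Here `γ / c = γ + ε / 4` and `c' = 1 / c`.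
    refine ⟨γ / (γ + ε / 4), (γ + ε / 4) / γ, by positivity, ?_, ?_, ?_, ?_⟩
    · rw [div_lt_one (by positivity)]; linarith
    · rw [one_lt_div hγ]; linarith
    · rw [div_div_cancel₀ hγ.ne']; linarith
    · rw [div_div_eq_mul_div, lt_div_iff₀ (by positivity)]; nlinarith
  have hc' : 0 < c' := one_pos.trans hc1'
  -- The tolerances are the distances of the limiting counts `1 / c` and `1 / c'` from 1, so the
  -- normalised counts stay on their own sides of 1.
  have e1 : 0 < 1 / c - 1 := sub_pos.2 ((one_lt_div hc).2 hc1)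
  have e2 : 0 < 1 - 1 / c' := sub_pos.2 ((div_lt_one hc').2 hc1')
  have hsum := ((hlln0 hc e1).add (hlln0 hc' e2)).add
    ((hlln1 hc (half_pos hε)).add (hlln1 hc' (half_pos hε)))
  simp only [add_zero] at hsum
  refine tendsto_of_tendsto_of_tendsto_of_le_of_le' tendsto_const_nhds hsum
    (Eventually.of_forall fun _ => zero_le) ?_
  have hm0 : (0 : ℝ) < m := by exact_mod_cast hm
  filter_upwards [hk.eventually_gt_atTop 1, hk₀.eventually_gt_atTop 0,
    (hk.const_mul_atTop (mul_pos hc hm0)).eventually hA.eventually_pos] with k hk1 hk0 hpos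
  have hk0' : (0 : ℝ) < k₀ k := by exact_mod_cast hk0
  rw [one_lt_div hk0', Nat.cast_lt] at hk1
  refine (measure_mono fun w hw => ?_).trans ((measure_union_le _ _).trans
    (add_le_add (measure_union_le _ _) (measure_union_le _ _)))
  -- Off the four exceptional events both counts trap the threshold and both sums are within `ε / 2`
  -- of their limits, so the estimator is within `ε` of `γ`.
  by_contra hnot
  simp only [Set.mem_union, Set.mem_ofPred_eq, not_or, not_le, abs_lt] at hnot hw
  obtain ⟨⟨a1, a2⟩, a3, a4⟩ := hnot
  have hmem := hill_mem_Icc hk0 hk1 (fun i : Fin k => blockMax X m i w) hpos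
    (by linarith [a1.1]) (by linarith [a2.2])
  rw [Real.dist_eq] at hw
  refine absurd hw (not_le.2 (abs_lt.2 ⟨?_, ?_⟩))
  · have := hmem.1
    change _ < hill _ _ - γ
    linarith [a4.1]
  · have := hmem.2
    change hill _ _ - γ < _
    linarith [a3.2]
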